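/- Let $T\ge 1$ be an integer and let $(\Omega,(\mathcal F_t)_{t\in\{0,\dots,T\}},P)$ be a filtered probability space. For a $\sigma$-algebra $\mathcal H$ and a set $E\subseteq\mathbb R^k$, $L^0(E,\mathcal H)$ denotes the set of $E$-valued $\mathcal H$-measurable random variables, identified when they are equal a.s. Let $S=(S_t)_{t\in\{0,\dots,T\}}$ be an adapted non-negative process with values in $\mathbb R^d$ (the prices of $d$ risky assets; the price of the riskless asset is $1$), and write $\Delta S_u=S_u-S_{u-1}$. For $t\in\{0,\dots,T\}$ put $$\mathcal R_t^T=\Big\{\sum_{u=t+1}^T\theta_{u-1}\cdot\Delta S_u-\epsilon^+ :\ \theta_{u-1}\in L^0(\mathbb R^d,\mathcal F_{u-1}),\ \epsilon^+\in L^0(\mathbb R_+,\mathcal F_T)\Big\},$$ and let $\mathcal P_{t,T}(0)=\{x\in L^0(\mathbb R,\mathcal F_t):\ x+R=0 \text{ a.s. for some } R\in\mathcal R_t^T\}$ for $t<T$ and $\mathcal P_{T,T}(0)=\{0\}$ be the set of super-hedging prices at time $t$ of the claim $0$. * $S$ satisfies AIP (absence of immediate profit) if $\mathcal P_{t,T}(0)\cap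 L^0(\mathbb R_-,\mathcal F_t)=\{0\}$ for every $t\in\{0,\dots,T\}$. * $S$ satisfies AWIP (absence of weak immediate profit) if $\overline{\mathcal R_t^T}\cap L^0(\mathbb R_+,\mathcal F_t)=\{0\}$ for every $t\in\{0,\dots,T\}$, where the closure is taken with respect to convergence in probability. The conditional essential infimum $\operatorname{ess\,inf}_{\mathcal F_0}X$ of a real random variable $X$ is the a.s. largest $\mathcal F_0$-measurable extended-real-valued random variable that is a.s. at most $X$. **Lemma.** The conditions AIP and AWIP are not equivalent, even for $d=1$. More precisely, for every $T\ge 1$: 1. Let $\tilde S=(\tilde S_t)_{t\in\{0,\dots,T\}}$ be a real-valued, a.s. positive $P$-martingale on a filtered probability space such that $\operatorname{ess\,inf}_{\mathcal F_0}\tilde S_1<\tilde S_1$ a.s., and define $S_0:=\operatorname{ess\,inf}_{\mathcal F_0}\tilde S_1$ (a real-valued version) and $S_t:=\tilde S_t$ for $t\in\{1,\dots,T\}$. Then $S$ is an adapted, a.s. non-negative process, $S$ satisfies AIP, and $S$ does not satisfy AWIP. 2. There exist a complete filtered probability space (every $P$-null set belongs to $\mathcal F_0$) and a martingale $\tilde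 S$ on it as in 1.; in particular there is a non-negative adapted real-valued process on a complete filtered probability space which satisfies AIP but not AWIP. -/

import Mathlib

open MeasureTheory ProbabilityTheory Filter
open scoped Topology

namespace ImmediateProfit

variable {Ω : Type*} {mΩ : MeasurableSpace Ω} {T d : ℕ}

/-- The filtered probability space is complete: every `P`-null set belongs to the initial
sigma-algebra (`P s` is the outer measure of an arbitrary set `s`, and `𝓕 0` is contained in
all the other sigma-algebras). -/
def IsCompleteFiltration (P : Measure Ω) (𝓕 : Filtration (Fin (T + 1)) mΩ) : Prop :=
  ∀ s : Set Ω, P s = 0 → MeasurableSet[𝓕 0] s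

/-- `m` is (a version of) the conditional essential infimum of the random variable `X` given the
sigma-algebra `H`: the largest `H`-measurable, possibly infinite, almost sure lower bound. -/
def IsCondEssInf (P : Measure Ω) (H : MeasurableSpace Ω) (X : Ω → ℝ) (m : Ω → EReal) : Prop :=
  Measurable[H] m ∧ (∀ᵐ ω ∂P, m ω ≤ (X ω : EReal)) ∧
    ∀ ζ : Ω → EReal, Measurable[H] ζ → (∀ᵐ ω ∂P, ζ ω ≤ (X ω : EReal)) → ∀ᵐ ω ∂P, ζ ω ≤ m ω

/-- An adapted (almost surely) non-negative process of prices of `d` risky assets,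
at the dates `0, …, T`. -/
def IsPriceProcess (P : Measure Ω) (𝓕 : Filtration (Fin (T + 1)) mΩ)
    (S : Fin (T + 1) → Ω → Fin d → ℝ) : Prop :=
  ∀ t, Measurable[𝓕 t] (S t) ∧ ∀ᵐ ω ∂P, ∀ i, 0 ≤ S t ω i

/-- The set `ℛ_t^T` of the claims (random variables up to almost sure equality) that can be
super-replicated from the zero endowment at time `t`: the claims
`∑_{u = t}^{T - 1} θ_u · (S_{u+1} - S_u) - ε` with `θ_u` measurable with respect to `𝓕 u` and `ε`
non-negative and measurable with respect to `𝓕 T`.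
An index `u : Fin T` stands for the trading period from the date `u` to the date `u + 1`. -/
def superReplicable (P : Measure Ω) (𝓕 : Filtration (Fin (T + 1)) mΩ)
    (S : Fin (T + 1) → Ω → Fin d → ℝ) (t : Fin (T + 1)) : Set (Ω → ℝ) :=
  {X | ∃ (θ : Fin T → Ω → Fin d → ℝ) (ε : Ω → ℝ),
    (∀ u : Fin T, Measurable[𝓕 u.castSucc] (θ u)) ∧
    Measurable[𝓕 (Fin.last T)] ε ∧ (∀ᵐ ω ∂P, 0 ≤ ε ω) ∧
    ∀ᵐ ω ∂P, X ω =
      (∑ u : Fin T with t ≤ u.castSucc, θ u ω ⬝ᵥ (S u.succ ω - S u.castSucc ω)) - ε ω}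

/-- The set `𝒫_{t,T}(g)` of the super-hedging prices at time `t` of the claim `g` paid at `T`;
at time `T` the only price of `g` is `g` itself. -/
def superHedgingPrices (P : Measure Ω) (𝓕 : Filtration (Fin (T + 1)) mΩ)
    (S : Fin (T + 1) → Ω → Fin d → ℝ) (g : Ω → ℝ) (t : Fin (T + 1)) : Set (Ω → ℝ) :=
  {x | Measurable[𝓕 t] x ∧
    (t = Fin.last T → x =ᵐ[P] g) ∧
    (t ≠ Fin.last T → ∃ R ∈ superReplicable P 𝓕 S t, x + R =ᵐ[P] g)}

/-- Absence of immediate profit: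
`𝒫_{t,T}(0) ∩ L⁰(ℝ₋, 𝓕 t) = {0}` for all `t`. -/
def AIP (P : Measure Ω) (𝓕 : Filtration (Fin (T + 1)) mΩ)
    (S : Fin (T + 1) → Ω → Fin d → ℝ) : Prop :=
  ∀ t : Fin (T + 1), ∀ x : Ω → ℝ, Measurable[𝓕 t] x →
    ((x ∈ superHedgingPrices P 𝓕 S 0 t ∧ ∀ᵐ ω ∂P, x ω ≤ 0) ↔ x =ᵐ[P] 0)

/-- The closure of a set of random variables for the (metrizable) topology of convergence in
probability, i.e. the set of the limits in probability of its sequences. -/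
def closureInProbability (P : Measure Ω) (R : Set (Ω → ℝ)) : Set (Ω → ℝ) :=
  {X | ∃ Y : ℕ → Ω → ℝ, (∀ n, Y n ∈ R) ∧ TendstoInMeasure P Y atTop X}

/-- Absence of weak immediate profit:
`closure (ℛ_t^T) ∩ L⁰(ℝ₊, 𝓕 t) = {0}` for all `t`. -/
def AWIP (P : Measure Ω) (𝓕 : Filtration (Fin (T + 1)) mΩ)
    (S : Fin (T + 1) → Ω → Fin d → ℝ) : Prop :=
  ∀ t : Fin (T + 1), ∀ x : Ω → ℝ, Measurable[𝓕 t] x →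
    ((x ∈ closureInProbability P (superReplicable P 𝓕 S t) ∧ ∀ᵐ ω ∂P, 0 ≤ x ω) ↔ x =ᵐ[P] 0)

/-- The price process of one risky asset (`d = 1`) which is `m` at time `0` and agrees with
the real process `M` at the times `1, …, T`. -/
def modifiedAtZero (M : Fin (T + 1) → Ω → ℝ) (m : Ω → ℝ) : Fin (T + 1) → Ω → Fin 1 → ℝ :=
  fun t ω _ => Function.update M 0 m t ω

end ImmediateProfit

/-!
The modified process starts at `m`, the conditional essential infimum of `M 1`, and then follows the
martingale `M`.

AIP holds. Trading in a martingale never dominates a claim known at the outset unless this claim is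
non-positive (`nonpos_of_le_martingale_gain`); as the strategies are not assumed integrable, the
proof goes backwards in time, one period after the other, with the strategy of each period
truncated. This settles the dates `t ≥ 1`. At the date `0` it shows that a profit `Y ≥ 0` known at
that date would satisfy `Y ≤ θ (M 1 - m)` for the position `θ` of the first period. Where `Y > 0`
this forces `θ > 0` and `m + Y / θ ≤ M 1`, against the maximality of `m`
(`IsCondEssInf.nonpos_of_le_mul_sub`).

AWIP fails. Since `m < M 1`, the claims `min (k (M 1 - m)) 1`, super-replicated by holding `k`
assets over the first period, converge to `1` (`not_AWIP_modifiedAtZero`).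

For the example take a probability measure on `ℕ` that charges every point, so that all filtrations
are complete, and a filtration that is trivial at the date `0` and reveals everything at the date
`1`. The martingale closed by `k ↦ 1 + 1 / (k + 1)` then has the conditional essential infimum `1`,
which is not attained.
-/

namespace ImmediateProfit

/-! ### Absence of arbitrage for martingales -/

/-- The trading periods from the date `u` on are `u` itself and those from the date `u + 1` on. -/
lemma sum_periods_castSucc {T : ℕ} (u : Fin T) (f : Fin T → ℝ) :
    ∑ v : Fin T with u.castSucc ≤ v.castSucc, f v =
      f u + ∑ v : Fin T with u.succ ≤ v.castSucc, f v := by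
  have h : Finset.univ.filter (fun v : Fin T => u.castSucc ≤ v.castSucc) =
      insert u (Finset.univ.filter (fun v : Fin T => u.succ ≤ v.castSucc)) := by
    ext v
    simp only [Finset.mem_filter, Finset.mem_univ, true_and, Finset.mem_insert, Fin.le_def,
      Fin.ext_iff, Fin.val_castSucc, Fin.val_succ]
    omega
  rw [h, Finset.sum_insert (by simp [Fin.le_def])]

/-- One-period absence of arbitrage. The strategy `θ` need not be integrable, so the conditional
expectation is taken after restriction to an `H`-measurable set on which `θ` is bounded. -/
lemma nonpos_of_le_mul_of_condExp_eq_zero {Ω : Type*} {H mΩ : MeasurableSpace Ω} {P : Measure Ω}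
    [IsFiniteMeasure P] (hH : H ≤ mΩ) {D θ Y : Ω → ℝ} (hD : Integrable D P)
    (hD0 : P[D|H] =ᵐ[P] 0) (hθ : Measurable[H] θ) (hY : Measurable[H] Y)
    (hle : ∀ᵐ ω ∂P, Y ω ≤ θ ω * D ω) : ∀ᵐ ω ∂P, Y ω ≤ 0 := by
  have key : ∀ n : ℕ, ∀ᵐ ω ∂P, |θ ω| ≤ n → Y ω ≤ 0 := by
    intro n
    set A : Set Ω := {ω | 0 < Y ω} ∩ {ω | |θ ω| ≤ n}
    have hA : MeasurableSet[H] A :=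
      (measurableSet_lt measurable_const hY).inter
        (measurableSet_le (continuous_abs.measurable.comp hθ) measurable_const)
    have hη : StronglyMeasurable[H] (A.indicator θ) := (hθ.indicator hA).stronglyMeasurable
    have hbound : ∀ ω, ‖A.indicator θ ω‖ ≤ n := by
      intro ω
      by_cases hω : ω ∈ A
      · simpa [hω] using hω.2
      · simp [hω]
    have hint : Integrable (A.indicator θ * D) P :=
      hD.bdd_mul (hη.mono hH).aestronglyMeasurable (ae_of_all _ hbound)
    have hzero : ∫ ω, (A.indicator θ * D) ω ∂P = 0 := by
      rw [← integral_condExp hH]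
      refine integral_eq_zero_of_ae ?_
      filter_upwards [condExp_stronglyMeasurable_mul_of_bound hH hη hD n (ae_of_all _ hbound),
        hD0] with ω h1 h2
      simp [h1, h2]
    have hnonneg : 0 ≤ᵐ[P] A.indicator θ * D := by
      filter_upwards [hle] with ω h
      by_cases hω : ω ∈ A
      · simpa [hω] using (le_of_lt hω.1).trans h
      · simp [hω]
    filter_upwards [(integral_eq_zero_iff_of_nonneg_ae hnonneg hint).1 hzero, hle] with ω h1 h2 h3
    by_contra! hpos
    have hω : ω ∈ A := ⟨hpos, h3⟩
    simp only [Pi.mul_apply, hω, Set.indicator_of_mem, Pi.zero_apply] at h1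
    linarith
  filter_upwards [ae_all_iff.2 key] with ω h
  obtain ⟨n, hn⟩ := exists_nat_ge |θ ω|
  exact h n hn

/-- Absence of arbitrage for a martingale between the dates `t` and `T`, by backward induction
on `t`: the gain from `t + 1` on dominates the `𝓕 (t + 1)`-measurable claim left after the first
period, hence that claim is non-positive and only one period remains. -/
lemma nonpos_of_le_martingale_gain {Ω : Type*} {mΩ : MeasurableSpace Ω} {P : Measure Ω}
    [IsFiniteMeasure P] {T : ℕ} {𝓕 : Filtration (Fin (T + 1)) mΩ} {M : Fin (T + 1) → Ω → ℝ}
    (hM : Martingale M 𝓕 P) {θ : Fin T → Ω → ℝ}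
    (hθ : ∀ u : Fin T, Measurable[𝓕 u.castSucc] (θ u)) (t : Fin (T + 1)) :
    ∀ Y : Ω → ℝ, Measurable[𝓕 t] Y →
      (∀ᵐ ω ∂P, Y ω ≤ ∑ u : Fin T with t ≤ u.castSucc,
        θ u ω * (M u.succ ω - M u.castSucc ω)) → ∀ᵐ ω ∂P, Y ω ≤ 0 := by
  induction t using Fin.reverseInduction with
  | last =>
    intro Y _ hle
    filter_upwards [hle] with ω h
    rwa [Finset.filter_false_of_mem (by simp [Fin.le_def]), Finset.sum_empty] at h
  | cast u ih =>
    intro Y hY hle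
    have hmono : 𝓕 u.castSucc ≤ 𝓕 u.succ := 𝓕.mono (Fin.castSucc_lt_succ).le
    have hrest : Measurable[𝓕 u.succ]
        (fun ω => Y ω - θ u ω * (M u.succ ω - M u.castSucc ω)) :=
      (hY.mono hmono le_rfl).sub (((hθ u).mono hmono le_rfl).mul
        ((hM.stronglyMeasurable _).measurable.sub
          ((hM.stronglyMeasurable _).measurable.mono hmono le_rfl)))
    have hone := ih _ hrest (by
      filter_upwards [hle] with ω h
      rw [sum_periods_castSucc] at h
      linarith)
    refine nonpos_of_le_mul_of_condExp_eq_zero (𝓕.le u.castSucc)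
      (D := M u.succ - M u.castSucc) ((hM.integrable _).sub (hM.integrable _)) ?_ (hθ u) hY ?_
    · filter_upwards [condExp_sub (hM.integrable u.succ) (hM.integrable u.castSucc)
        (𝓕 u.castSucc), hM.condExp_ae_eq (Fin.castSucc_lt_succ (i := u)).le,
        hM.condExp_ae_eq (le_refl u.castSucc)] with ω h1 h2 h3
      simp [h1, h2, h3]
    · filter_upwards [hone] with ω h
      simp only [Pi.sub_apply]
      linarith

/-! ### Prices of the modified process -/

lemma modifiedAtZero_zero {Ω : Type*} {T : ℕ} (M : Fin (T + 1) → Ω → ℝ) (m : Ω → ℝ) (ω : Ω)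
    (i : Fin 1) : modifiedAtZero M m 0 ω i = m ω := by
  simp [modifiedAtZero]

lemma modifiedAtZero_of_ne_zero {Ω : Type*} {T : ℕ} (M : Fin (T + 1) → Ω → ℝ) (m : Ω → ℝ)
    {t : Fin (T + 1)} (ht : t ≠ 0) (ω : Ω) (i : Fin 1) : modifiedAtZero M m t ω i = M t ω := by
  simp [modifiedAtZero, ht]

lemma IsCondEssInf.measurable_of_coe {Ω : Type*} {H mΩ : MeasurableSpace Ω} {P : Measure Ω}
    {X m : Ω → ℝ} (h : IsCondEssInf P H X (fun ω => (m ω : EReal))) : Measurable[H] m := by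
  simpa [Function.comp_def] using measurable_ereal_toReal.comp h.1

lemma isPriceProcess_modifiedAtZero {Ω : Type*} {mΩ : MeasurableSpace Ω} {P : Measure Ω} {T : ℕ}
    {𝓕 : Filtration (Fin (T + 1)) mΩ} {M : Fin (T + 1) → Ω → ℝ} {m X : Ω → ℝ}
    (hM : Martingale M 𝓕 P) (hpos : ∀ t, ∀ᵐ ω ∂P, 0 < M t ω) (hX : ∀ᵐ ω ∂P, 0 ≤ X ω)
    (hm : IsCondEssInf P (𝓕 0) X (fun ω => (m ω : EReal))) :
    IsPriceProcess P 𝓕 (modifiedAtZero M m) := by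
  intro t
  by_cases ht : t = 0
  · subst ht
    refine ⟨@measurable_pi_lambda _ _ _ (𝓕 0) _ _ fun i => ?_, ?_⟩
    · simpa only [modifiedAtZero_zero] using hm.measurable_of_coe
    · filter_upwards [hm.2.2 (fun _ => 0) measurable_const
        (by filter_upwards [hX] with ω h; exact_mod_cast h)] with ω h i
      rw [modifiedAtZero_zero]
      exact_mod_cast h
  · refine ⟨@measurable_pi_lambda _ _ _ (𝓕 t) _ _ fun i => ?_, ?_⟩
    · simpa only [modifiedAtZero_of_ne_zero M m ht] using (hM.stronglyMeasurable t).measurable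
    · filter_upwards [hpos t] with ω h i
      rw [modifiedAtZero_of_ne_zero M m ht]
      exact h.le

/-- From a date `t ≠ 0` on, trading in the modified process is trading in `M`. -/
lemma gain_modifiedAtZero_of_ne_zero {Ω : Type*} {T : ℕ} (M : Fin (T + 1) → Ω → ℝ) (m : Ω → ℝ)
    {t : Fin (T + 1)} (ht : t ≠ 0) (θ : Fin T → Ω → Fin 1 → ℝ) (ω : Ω) :
    ∑ u : Fin T with t ≤ u.castSucc,
        θ u ω ⬝ᵥ (modifiedAtZero M m u.succ ω - modifiedAtZero M m u.castSucc ω) =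
      ∑ u : Fin T with t ≤ u.castSucc, θ u ω 0 * (M u.succ ω - M u.castSucc ω) := by
  refine Finset.sum_congr rfl fun u hu => ?_
  have hu0 : u.castSucc ≠ 0 := fun h =>
    ht (le_antisymm (h ▸ (Finset.mem_filter.1 hu).2) (Fin.zero_le t))
  simp [dotProduct, modifiedAtZero_of_ne_zero M m hu0,
    modifiedAtZero_of_ne_zero M m (Fin.succ_ne_zero u)]

/-- From the date `0` on, the gain is that of the first period, started at the price `m`, plus a
gain of trading in `M`. -/
lemma gain_modifiedAtZero_zero {Ω : Type*} {n : ℕ} (M : Fin (n + 1 + 1) → Ω → ℝ) (m : Ω → ℝ)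
    (θ : Fin (n + 1) → Ω → Fin 1 → ℝ) (ω : Ω) :
    ∑ u : Fin (n + 1) with 0 ≤ u.castSucc,
        θ u ω ⬝ᵥ (modifiedAtZero M m u.succ ω - modifiedAtZero M m u.castSucc ω) =
      θ 0 ω 0 * (M 1 ω - m ω) +
        ∑ u : Fin (n + 1) with 1 ≤ u.castSucc, θ u ω 0 * (M u.succ ω - M u.castSucc ω) := by
  have h := sum_periods_castSucc (0 : Fin (n + 1)) (fun u =>
    θ u ω ⬝ᵥ (modifiedAtZero M m u.succ ω - modifiedAtZero M m u.castSucc ω))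
  rw [Fin.castSucc_zero, Fin.succ_zero_eq_one] at h
  rw [h, gain_modifiedAtZero_of_ne_zero M m (by simp)]
  simp [dotProduct, modifiedAtZero_zero, modifiedAtZero_of_ne_zero M m (one_ne_zero)]

/-! ### Absence of immediate profit -/

/-- No `H`-measurable strategy gains a positive `H`-measurable amount over one period started at
the conditional essential infimum `m` of `X`: where `0 < Y ≤ θ (X - m)`, necessarily `0 < θ`,
and `m + Y / θ` would be a larger lower bound of `X`. -/
lemma IsCondEssInf.nonpos_of_le_mul_sub {Ω : Type*} {H mΩ : MeasurableSpace Ω} {P : Measure Ω}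
    {X m θ Y : Ω → ℝ} (hm : IsCondEssInf P H X (fun ω => (m ω : EReal)))
    (hθ : Measurable[H] θ) (hY : Measurable[H] Y)
    (hle : ∀ᵐ ω ∂P, Y ω ≤ θ ω * (X ω - m ω)) : ∀ᵐ ω ∂P, Y ω ≤ 0 := by
  have hmm := hm.measurable_of_coe
  have hmX : ∀ᵐ ω ∂P, m ω ≤ X ω := by
    filter_upwards [hm.2.1] with ω h
    exact_mod_cast h
  set A : Set Ω := {ω | 0 < Y ω} ∩ {ω | 0 < θ ω}
  have hA : MeasurableSet[H] A :=
    (measurableSet_lt measurable_const hY).inter (measurableSet_lt measurable_const hθ)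
  have hζ : Measurable[H] fun ω => m ω + A.indicator (fun ω => Y ω / θ ω) ω :=
    hmm.add ((hY.div hθ).indicator hA)
  have hζX : ∀ᵐ ω ∂P, m ω + A.indicator (fun ω => Y ω / θ ω) ω ≤ X ω := by
    filter_upwards [hle, hmX] with ω h1 h2
    by_cases hω : ω ∈ A
    · have : Y ω / θ ω ≤ X ω - m ω := (div_le_iff₀' hω.2).2 h1
      simp only [hω, Set.indicator_of_mem]
      linarith
    · simpa [hω] using h2
  filter_upwards [hm.2.2 _ (measurable_coe_real_ereal.comp hζ)
    (by filter_upwards [hζX] with ω h; exact EReal.coe_le_coe_iff.2 h), hle, hmX] with ω h1 h2 h3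
  by_contra! hpos
  have hθpos : 0 < θ ω := by
    by_contra! hneg
    nlinarith
  have hω : ω ∈ A := ⟨hpos, hθpos⟩
  have h4 : m ω + A.indicator (fun ω => Y ω / θ ω) ω ≤ m ω := EReal.coe_le_coe_iff.1 h1
  simp only [hω, Set.indicator_of_mem] at h4
  linarith [div_pos hpos hθpos]

/-- The zero price super-hedges the zero claim, so only the non-trivial inclusion has to be
checked to have AIP. -/
lemma AIP_of_forall_nonneg {Ω : Type*} {mΩ : MeasurableSpace Ω} {P : Measure Ω} {T d : ℕ}
    {𝓕 : Filtration (Fin (T + 1)) mΩ} {S : Fin (T + 1) → Ω → Fin d → ℝ}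
    (h : ∀ t, t ≠ Fin.last T → ∀ x : Ω → ℝ, Measurable[𝓕 t] x →
      ∀ θ : Fin T → Ω → Fin d → ℝ, (∀ u : Fin T, Measurable[𝓕 u.castSucc] (θ u)) →
      (∀ᵐ ω ∂P, -x ω ≤ ∑ u : Fin T with t ≤ u.castSucc,
        θ u ω ⬝ᵥ (S u.succ ω - S u.castSucc ω)) → ∀ᵐ ω ∂P, -x ω ≤ 0) :
    AIP P 𝓕 S := by
  intro t x hx
  constructor
  · rintro ⟨⟨-, hlast, hne⟩, hx0⟩
    by_cases ht : t = Fin.last T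
    · exact hlast ht
    · obtain ⟨R, ⟨θ, ε, hθ, -, hε0, hR⟩, hxR⟩ := hne ht
      have := h t ht x hx θ hθ (by
        filter_upwards [hε0, hR, hxR] with ω h1 h2 h3
        simp only [Pi.add_apply, Pi.zero_apply] at h3
        linarith)
      filter_upwards [this, hx0] with ω h1 h2
      simp only [Pi.zero_apply]
      linarith
  · intro hx0
    refine ⟨⟨hx, fun _ => hx0, fun _ => ⟨0, ⟨0, 0, fun _ => measurable_const, measurable_const,
      by simp, by simp⟩, by simpa using hx0⟩⟩, ?_⟩
    filter_upwards [hx0] with ω h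
    simp [h]

lemma AIP_modifiedAtZero {Ω : Type*} {mΩ : MeasurableSpace Ω} {P : Measure Ω} [IsFiniteMeasure P]
    {n : ℕ} {𝓕 : Filtration (Fin (n + 1 + 1)) mΩ} {M : Fin (n + 1 + 1) → Ω → ℝ} {m : Ω → ℝ}
    (hM : Martingale M 𝓕 P) (hm : IsCondEssInf P (𝓕 0) (M 1) (fun ω => (m ω : EReal))) :
    AIP P 𝓕 (modifiedAtZero M m) := by
  refine AIP_of_forall_nonneg fun t _ x hx θ hθ hle => ?_
  have hθ' : ∀ u : Fin (n + 1), Measurable[𝓕 u.castSucc] (fun ω => θ u ω 0) :=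
    fun u => (measurable_pi_apply 0).comp (hθ u)
  by_cases ht : t = 0
  · subst ht
    simp only [gain_modifiedAtZero_zero] at hle
    have hθ0 : Measurable[𝓕 0] (fun ω => θ 0 ω 0) := hθ' 0
    have h01 : 𝓕 0 ≤ 𝓕 1 := 𝓕.mono (Fin.zero_le 1)
    -- Trading in `M` after the date `1` cannot make up for a loss in the first period.
    have hone := nonpos_of_le_martingale_gain hM hθ' 1
      (fun ω => -x ω - θ 0 ω 0 * (M 1 ω - m ω))
      ((hx.neg.mono h01 le_rfl).sub ((hθ0.mono h01 le_rfl).mul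
        ((hM.stronglyMeasurable 1).measurable.sub (hm.measurable_of_coe.mono h01 le_rfl))))
      (by filter_upwards [hle] with ω h; linarith)
    exact hm.nonpos_of_le_mul_sub hθ0 hx.neg
      (by filter_upwards [hone] with ω h; linarith)
  · simp only [gain_modifiedAtZero_of_ne_zero M m ht] at hle
    exact nonpos_of_le_martingale_gain hM hθ' t _ hx.neg hle

/-! ### Weak immediate profit -/

/-- Holding `k` assets over the first period gains `k (M 1 - m)`, which dominates the claim
`min (k (M 1 - m)) 1`; these claims converge to the immediate profit `1`. -/
lemma not_AWIP_modifiedAtZero {Ω : Type*} {mΩ : MeasurableSpace Ω} {P : Measure Ω}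
    [IsProbabilityMeasure P] {n : ℕ} {𝓕 : Filtration (Fin (n + 1 + 1)) mΩ}
    {M : Fin (n + 1 + 1) → Ω → ℝ} {m : Ω → ℝ} (hM1 : Measurable[𝓕 1] (M 1))
    (hm : Measurable[𝓕 0] m) (hlt : ∀ᵐ ω ∂P, m ω < M 1 ω) :
    ¬ AWIP P 𝓕 (modifiedAtZero M m) := by
  intro h
  have hgain : Measurable[𝓕 (Fin.last (n + 1))] fun ω => M 1 ω - m ω :=
    (hM1.mono (𝓕.mono (Fin.le_last 1)) le_rfl).sub (hm.mono (𝓕.mono (Fin.zero_le _)) le_rfl)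
  have hone : (fun _ : Ω => (1 : ℝ)) ∈
      closureInProbability P (superReplicable P 𝓕 (modifiedAtZero M m) 0) := by
    refine ⟨fun k ω => min (k * (M 1 ω - m ω)) 1, fun k => ?_, ?_⟩
    · refine ⟨fun u _ _ => if u = 0 then (k : ℝ) else 0,
        fun ω => max (k * (M 1 ω - m ω) - 1) 0, fun _ => measurable_const,
        ((hgain.const_mul _).sub_const _).max measurable_const,
        ae_of_all _ fun ω => le_max_right _ _, ae_of_all _ fun ω => ?_⟩
      have hg := gain_modifiedAtZero_zero M m (fun u _ _ => if u = 0 then (k : ℝ) else 0) ω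
      beta_reduce
      rw [hg, Finset.sum_eq_zero]
      · rcases le_total (k * (M 1 ω - m ω)) 1 with h1 | h1
        · rw [min_eq_left h1, max_eq_right (by linarith)]
          simp
        · rw [min_eq_right h1, max_eq_left (by linarith)]
          simp
      · intro u hu
        have hu0 : u ≠ 0 := by
          rintro rfl
          simp [Fin.le_def] at hu
        simp [hu0]
    · refine tendstoInMeasure_of_tendsto_ae (fun k => ?_) ?_
      · exact (((hgain.mono (𝓕.le _) le_rfl).const_mul _).min
          measurable_const).aestronglyMeasurable
      · filter_upwards [hlt] with ω hω
        obtain ⟨N, hN⟩ := exists_nat_ge (1 / (M 1 ω - m ω))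
        refine tendsto_const_nhds.congr' ?_
        filter_upwards [eventually_ge_atTop N] with k hk
        have hpos : 0 < M 1 ω - m ω := sub_pos.2 hω
        have hNk : (N : ℝ) ≤ k := by exact_mod_cast hk
        exact (min_eq_right ((div_le_iff₀ hpos).1 (hN.trans hNk))).symm
  have h0 := (h 0 (fun _ => 1) measurable_const).1 ⟨hone, ae_of_all _ fun _ => zero_le_one⟩
  obtain ⟨ω, hω⟩ := h0.exists
  exact one_ne_zero hω

lemma modifiedAtZero_AIP_not_AWIP {Ω : Type*} {mΩ : MeasurableSpace Ω} {P : Measure Ω}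
    [IsProbabilityMeasure P] {n : ℕ} {𝓕 : Filtration (Fin (n + 1 + 1)) mΩ}
    {M : Fin (n + 1 + 1) → Ω → ℝ} {m : Ω → ℝ} (hM : Martingale M 𝓕 P)
    (hpos : ∀ t, ∀ᵐ ω ∂P, 0 < M t ω)
    (hm : IsCondEssInf P (𝓕 0) (M 1) (fun ω => (m ω : EReal))) (hlt : ∀ᵐ ω ∂P, m ω < M 1 ω) :
    IsPriceProcess P 𝓕 (modifiedAtZero M m) ∧ AIP P 𝓕 (modifiedAtZero M m) ∧
      ¬ AWIP P 𝓕 (modifiedAtZero M m) :=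
  ⟨isPriceProcess_modifiedAtZero hM hpos ((hpos 1).mono fun _ h => h.le) hm,
    AIP_modifiedAtZero hM hm,
    not_AWIP_modifiedAtZero (hM.stronglyMeasurable 1).measurable hm.measurable_of_coe hlt⟩

/-! ### An example on a countable space -/

/-- The filtration on a discrete space under which nothing is known at the date `0` and everything
is known from the date `1` on. -/
def revealingFiltration (Ω : Type*) (T : ℕ) : Filtration (Fin (T + 1)) (⊤ : MeasurableSpace Ω) where
  seq t := if t = 0 then ⊥ else ⊤
  mono' s t hst := by
    by_cases hs : s = 0
    · simp [hs]
    · have ht : t ≠ 0 := fun h => hs (le_antisymm (h ▸ hst) (Fin.zero_le s))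
      simp [hs, ht]
  le' _ := le_top

/-- If every point has positive mass, then the empty set is the only null set, and every filtration
is complete. -/
lemma isCompleteFiltration_of_singleton_ne_zero {Ω : Type*} {mΩ : MeasurableSpace Ω}
    {P : Measure Ω} (hP : ∀ ω, P {ω} ≠ 0) {T : ℕ} (𝓕 : Filtration (Fin (T + 1)) mΩ) :
    IsCompleteFiltration P 𝓕 := by
  intro s hs
  have : s = ∅ := Set.eq_empty_iff_forall_notMem.2 fun ω hω =>
    hP ω (measure_mono_null (Set.singleton_subset_iff.2 hω) hs)
  rw [this]
  exact @MeasurableSet.empty _ (𝓕 0)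

/-- Given the trivial sigma-algebra, the conditional essential infimum is the infimum, if every
point has positive mass. -/
lemma isCondEssInf_bot_of_isGLB {Ω : Type*} {mΩ : MeasurableSpace Ω} {P : Measure Ω}
    (hP : ∀ ω, P {ω} ≠ 0) {X : Ω → ℝ} {c : ℝ} (hc : IsGLB (Set.range X) c) [Nonempty Ω] :
    IsCondEssInf P ⊥ X (fun _ => (c : EReal)) := by
  refine ⟨measurable_const, ae_of_all _ fun ω => ?_, fun ζ hζ hle => ?_⟩
  · exact EReal.coe_le_coe_iff.2 (hc.1 ⟨ω, rfl⟩)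
  · obtain ⟨z, rfl⟩ := stronglyMeasurable_bot_iff.1 hζ.stronglyMeasurable
    have hall : ∀ ω, z ≤ (X ω : EReal) := fun ω => by
      by_contra hω
      exact hP ω (measure_mono_null (Set.singleton_subset_iff.2 hω) hle)
    refine ae_of_all _ fun _ => ?_
    induction z with
    | bot => exact bot_le
    | coe z =>
      have : z ∈ lowerBounds (Set.range X) := by
        rintro _ ⟨ω, rfl⟩
        exact_mod_cast hall ω
      exact EReal.coe_le_coe_iff.2 (hc.2 this)
    | top => exact absurd (hall (Classical.arbitrary Ω)) (by simp)

lemma isGLB_range_one_add_inv : IsGLB (Set.range fun k : ℕ => 1 + 1 / ((k : ℝ) + 1)) 1 := by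
  refine ⟨?_, fun b hb => ?_⟩
  · rintro _ ⟨k, rfl⟩
    have : 0 < 1 / ((k : ℝ) + 1) := Nat.one_div_pos_of_nat
    simp only
    linarith
  · have h := (tendsto_one_div_add_atTop_nhds_zero_nat (𝕜 := ℝ)).const_add 1
    rw [add_zero] at h
    exact ge_of_tendsto' h fun k => hb ⟨k, rfl⟩

/-- A positive martingale on a complete filtered probability space whose value at the date `1` is
above its conditional essential infimum. -/
lemma exists_martingale_condEssInf_lt (n : ℕ) :
    ∃ (Ω : Type) (mΩ : MeasurableSpace Ω) (P : Measure Ω) (_ : IsProbabilityMeasure P)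
      (𝓕 : Filtration (Fin (n + 1 + 1)) mΩ) (M : Fin (n + 1 + 1) → Ω → ℝ) (m : Ω → ℝ),
      IsCompleteFiltration P 𝓕 ∧ Martingale M 𝓕 P ∧ (∀ t, ∀ᵐ ω ∂P, 0 < M t ω) ∧
      IsCondEssInf P (𝓕 0) (M 1) (fun ω => (m ω : EReal)) ∧ (∀ᵐ ω ∂P, m ω < M 1 ω) := by
  obtain ⟨p, hp0, hp1⟩ : ∃ p : unitInterval, p ≠ 0 ∧ p ≠ 1 :=
    ⟨⟨1 / 2, by norm_num, by norm_num⟩, by simp [← Subtype.coe_ne_coe], by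
      rw [← Subtype.coe_ne_coe]; norm_num⟩
  have hatom : ∀ k : ℕ, geometricMeasure p {k} ≠ 0 := fun k h => by
    have := geometricMeasure_real_singleton_pos hp0 hp1 k
    rw [measureReal_def, h] at this
    simp at this
  set P := geometricMeasure p
  set 𝓕 : Filtration (Fin (n + 1 + 1)) (⊤ : MeasurableSpace ℕ) := revealingFiltration ℕ (n + 1)
  set X : ℕ → ℝ := fun k => 1 + 1 / ((k : ℝ) + 1)
  have hX1 : ∀ k, 1 < X k := fun k => by
    have : 0 < 1 / ((k : ℝ) + 1) := Nat.one_div_pos_of_nat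
    simp only [X]
    linarith
  have hX2 : ∀ k, X k ≤ 2 := fun k => by
    have : 1 / ((k : ℝ) + 1) ≤ 1 := by
      rw [div_le_one (by positivity)]
      linarith [Nat.cast_nonneg (α := ℝ) k]
    simp only [X]
    linarith
  have hint : Integrable X P := Integrable.of_bound (C := 2)
    (measurable_from_top).aestronglyMeasurable (ae_of_all _ fun k => by
      rw [Real.norm_of_nonneg (zero_le_one.trans (hX1 k).le)]
      exact hX2 k)
  have h0 : 𝓕 0 = ⊥ := by simp [𝓕, revealingFiltration]
  have h1 : P[X|𝓕 1] = X := by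
    refine condExp_of_stronglyMeasurable (𝓕.le 1) ?_ hint
    have : 𝓕 1 = ⊤ := by simp [𝓕, revealingFiltration]
    rw [this]
    exact Measurable.stronglyMeasurable measurable_from_top
  refine ⟨ℕ, ⊤, P, inferInstance, 𝓕, fun t => P[X|𝓕 t], fun _ => 1,
    isCompleteFiltration_of_singleton_ne_zero hatom 𝓕, martingale_condExp X 𝓕 P, fun t => ?_,
    ?_, ?_⟩
  · have h := condExp_mono (m := 𝓕 t) (integrable_const (1 : ℝ)) hint
      (ae_of_all P fun k => (hX1 k).le)
    rw [condExp_const (𝓕.le t)] at h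
    filter_upwards [h] with k hk
    exact zero_lt_one.trans_le hk
  · beta_reduce
    rw [h0, h1]
    exact isCondEssInf_bot_of_isGLB hatom isGLB_range_one_add_inv
  · beta_reduce
    rw [h1]
    exact ae_of_all _ hX1

end ImmediateProfit

theorem lemma3p2 (T : ℕ) (hT : 1 ≤ T) :
    (∃ (Ω : Type) (mΩ : MeasurableSpace Ω) (P : Measure Ω) (_ : IsProbabilityMeasure P)
        (𝓕 : Filtration (Fin (T + 1)) mΩ) (M : Fin (T + 1) → Ω → ℝ) (m : Ω → ℝ),
      ImmediateProfit.IsCompleteFiltration P 𝓕 ∧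
      Martingale M 𝓕 P ∧ (∀ t, ∀ᵐ ω ∂P, 0 < M t ω) ∧
      ImmediateProfit.IsCondEssInf P (𝓕 0) (M 1) (fun ω => (m ω : EReal)) ∧
      (∀ᵐ ω ∂P, m ω < M 1 ω) ∧
      ImmediateProfit.IsPriceProcess P 𝓕 (ImmediateProfit.modifiedAtZero M m) ∧
      ImmediateProfit.AIP P 𝓕 (ImmediateProfit.modifiedAtZero M m) ∧
      ¬ ImmediateProfit.AWIP P 𝓕 (ImmediateProfit.modifiedAtZero M m)) ∧
    (∀ {Ω : Type*} {mΩ : MeasurableSpace Ω} (P : Measure Ω) [IsProbabilityMeasure P]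
        (𝓕 : Filtration (Fin (T + 1)) mΩ) (M : Fin (T + 1) → Ω → ℝ) (m : Ω → ℝ),
      Martingale M 𝓕 P → (∀ t, ∀ᵐ ω ∂P, 0 < M t ω) →
      ImmediateProfit.IsCondEssInf P (𝓕 0) (M 1) (fun ω => (m ω : EReal)) →
      (∀ᵐ ω ∂P, m ω < M 1 ω) →
      ImmediateProfit.IsPriceProcess P 𝓕 (ImmediateProfit.modifiedAtZero M m) ∧
      ImmediateProfit.AIP P 𝓕 (ImmediateProfit.modifiedAtZero M m) ∧
      ¬ ImmediateProfit.AWIP P 𝓕 (ImmediateProfit.modifiedAtZero M m)) := by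
  obtain ⟨n, rfl⟩ := Nat.exists_eq_add_of_le' hT
  refine ⟨?_, fun P _ 𝓕 M m hM hpos hm hlt =>
    ImmediateProfit.modifiedAtZero_AIP_not_AWIP hM hpos hm hlt⟩
  obtain ⟨Ω, mΩ, P, hP, 𝓕, M, m, hc, hM, hpos, hm, hlt⟩ :=
    ImmediateProfit.exists_martingale_condEssInf_lt n
  exact ⟨Ω, mΩ, P, hP, 𝓕, M, m, hc, hM, hpos, hm, hlt,
    ImmediateProfit.modifiedAtZero_AIP_not_AWIP hM hpos hm hlt⟩
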